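/- Let $L$ be a number field with ring of integers $\mathbb{Z}_L$ and $d_L=[L:\mathbb{Q}]$. For $a\in L$ let $h(a)=\sum_v \frac{d_v}{d_L}\log\max\{1,|a|_v\}$ be the absolute logarithmic Weil height, where $v$ runs over all places of $L$, $d_v=[L_v:\mathbb{Q}_v]$, and $|\cdot|_v$ is the absolute value extending the standard one on $\mathbb{Q}$. For $P=\sum_{i=0}^n a_iX^i\in L[X]$ let $h(P)=\sum_v \frac{d_v}{d_L}\log\max\{1,|a_0|_v,\ldots,|a_n|_v\}$. There exists a real constant $C$, depending only on $L$, with the following property: for every $P\in L[X]$ there is a nonzero $a\in\mathbb{Z}_L$ such that $aP\in\mathbb{Z}_L[X]$ and $\max\{h(a),h(aP)\}\le h(P)+C$. Let $C$ be any such constant. Let $A,B\in\mathbb{Z}$, write $D=B-A$ and $M=\max\{|A|,|B|\}$. Let $F\in L(X)\setminus\{0\}$ be a rational fraction, let $d_P$ and $d_Q$ be the degrees of its numerator and denominator in lowest terms, and assume that the degree $d=\max\{d_P,d_Q\}$ of $F$ is at least $1$. Let $x_1,\ldots,x_{d_P+d_Q+1}$ be distinct integers in $[A,B]$ that are not poles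 of $F$, let $H\in\mathbb{R}$, and assume that $h(F(x_i))\le H$ for every $i$. Then there exist polynomials $P,Q\in\mathbb{Z}_L[X]$ with $Q\neq 0$ such that $F=P/Q$, $\deg P=d_P$, $\deg Q=d_Q$, and $$\max\{h(P),h(Q)\}\le (d+1)(2d+1)H+(d+1)D\log D+(4d^2+3d)\log(2M)+(2d+2)\log(2d+1)+(d+1)C.$$ -/

import Mathlib

open Polynomial NumberField

noncomputable section

/-- The absolute logarithmic Weil height of an element `a` of a number field `L`:
`h(a) = (1 / [L : ℚ]) * ∑ v, d_v * log (max 1 |a|_v)`, the sum being over all places of `L`, with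
`|·|_v` normalized to extend the usual absolute values of `ℚ`. Mathlib's `Height.logHeight₁` is the
sum (it already includes the local degrees `d_v`: as multiplicities at the infinite places, and in
the normalization of the absolute values at the finite places). -/
def weilHeight {L : Type*} [Field L] [NumberField L] (a : L) : ℝ :=
  Height.logHeight₁ a / (Module.finrank ℚ L : ℝ)

/-- The absolute logarithmic Weil height of a polynomial `P = ∑ i ≤ n, a_i X ^ i` over a number
field `L`: the affine height of the tuple `(a_0, …, a_n)`, that is, the projective height of
`(1 : a_0 : … : a_n)`. The entry `1` is placed at the index `none`. -/
def polyHeight {L : Type*} [Field L] [NumberField L] (P : L[X]) : ℝ :=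
  Height.logHeight (fun i : Option (Fin (P.natDegree + 1)) ↦ i.elim (1 : L) (fun j ↦ P.coeff j))
    / (Module.finrank ℚ L : ℝ)

/-- The polynomial over `L` with the same coefficients as a polynomial over the ring of
integers of `L`. -/
def intPolyToField {L : Type*} [Field L] (P : (𝓞 L)[X]) : L[X] :=
  P.map (algebraMap (𝓞 L) L)

/-- `C` is a *denominator constant* for the number field `L`: every polynomial `P ∈ L[X]` has a
nonzero common denominator `a`, an algebraic integer of `L`, such that
`max {h(a), h(a P)} ≤ h(P) + C`. -/
def IsDenominatorConstant (L : Type*) [Field L] [NumberField L] (C : ℝ) : Prop :=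
  ∀ P : L[X], ∃ a : 𝓞 L, a ≠ 0 ∧
    (∃ T : (𝓞 L)[X], intPolyToField T = Polynomial.C (a : L) * P) ∧
    max (weilHeight (a : L)) (polyHeight (Polynomial.C (a : L) * P)) ≤ polyHeight P + C

end

/-! Scale the reduced denominator of F to be monic. The coefficient vector u of numerator and
denominator then solves a square linear system: one equation P(x_i) - F(x_i) Q(x_i) = 0 per point,
and one fixing the leading coefficient of Q to be 1. Uniqueness of rational interpolation
(`eq_zero_of_interpolation`) makes the system invertible. By Cramer's rule u is proportional to a
column of the adjugate, whose entries are signed sums of products with one factor from each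
interpolation row. Heights add under tensor products, so h(u) is at most the sum of the row heights
plus the log of the factorial of the size (`logHeight_le_of_mulVec_eq_single`). Each row costs at
most h(F(x_i)) + d log M. Packing both coefficient lists into one polynomial lets a single
denominator a clear them together, at the cost of one C.

That C exists by Minkowski: the common denominators of a tuple form a fractional ideal J whose norm
is the finite part of its height, and J contains a nonzero element whose archimedean absolute values
are all controlled by that norm. -/

namespace Height

/-! ### Projective heights: subtuples, powers, Cramer's rule -/

variable {K : Type*} [Field K] [AdmissibleAbsValues K] {ι ι' : Type*} [Finite ι] [Finite ι']

lemma logHeight_le_of_forall_eq_zero_or_exists_eq {x : ι → K} {y : ι' → K}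
    (h : ∀ i, x i = 0 ∨ ∃ j, x i = y j) : logHeight x ≤ logHeight y := by
  have h' : ∀ i : x.support, ∃ j, x i = y j := fun i ↦ (h i).resolve_left i.2
  choose f hf using h'
  rw [logHeight_eq_logHeight_restrict_support, show (fun i : x.support ↦ x i) = y ∘ f from funext hf]
  exact logHeight_comp_le f y

lemma logHeight_eq_zero_of_forall {x : ι → K} (h : ∀ i, x i = 0 ∨ x i = 1 ∨ x i = -1) :
    logHeight x = 0 := by
  refine le_antisymm ?_ (logHeight_nonneg x)
  have h1 : logHeight ![(-1 : K), 1] = 0 := by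
    rw [← logHeight₁_eq_logHeight, logHeight₁_neg, logHeight₁_one]
  rw [← h1]
  refine logHeight_le_of_forall_eq_zero_or_exists_eq fun i ↦ ?_
  rcases h i with h | h | h
  · exact .inl h
  · exact .inr ⟨1, by simp [h]⟩
  · exact .inr ⟨0, by simp [h]⟩

/-- The powers of x are among the coordinates of the d-fold tensor power of (x, 1), whose height is
d times that of x. -/
lemma logHeight_pow_range_le (x : K) (d : ℕ) :
    logHeight (fun j : Fin (d + 1) ↦ x ^ (j : ℕ)) ≤ d * logHeight₁ x := by
  have h := logHeight_fun_prod_eq (K := K) (α := Fin d) (ι := fun _ ↦ Fin 2)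
    (x := fun _ ↦ ![x, 1]) fun _ ↦ by simp
  rw [Finset.sum_const, Finset.card_univ, Fintype.card_fin, nsmul_eq_mul,
    ← logHeight₁_eq_logHeight] at h
  rw [← h]
  refine logHeight_le_of_forall_eq_zero_or_exists_eq fun j ↦ .inr
    ⟨fun a ↦ if (a : ℕ) < j then 0 else 1, ?_⟩
  have h2 : ∀ a : Fin d, (![x, 1] : Fin 2 → K) (if (a : ℕ) < j then 0 else 1)
      = if (a : ℕ) < j then x else 1 := fun a ↦ by split_ifs <;> simp
  simp only [h2]
  rw [Fin.prod_univ_eq_prod_range (fun a ↦ if a < (j : ℕ) then x else 1) d,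
    Finset.prod_ite, Finset.prod_const, Finset.prod_const_one, mul_one]
  congr 1
  rw [show (Finset.range d).filter (· < (j : ℕ)) = Finset.range j by
    ext a; have := j.2; simp; omega, Finset.card_range]

/-- The height of a row of the linear system for rational interpolation. -/
lemma logHeight_interpolation_row_le (x y : K) {m n d : ℕ} (hm : m ≤ d) (hn : n ≤ d) :
    logHeight (Sum.elim (fun j : Fin (m + 1) ↦ x ^ (j : ℕ))
      (fun j : Fin (n + 1) ↦ -(y * x ^ (j : ℕ)))) ≤ logHeight₁ y + d * logHeight₁ x := by
  refine le_trans ?_ (add_le_add_right (logHeight_pow_range_le x d) _)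
  -- The row is a subfamily of the tensor product of (-y, 1) with the powers of x.
  rw [← logHeight₁_neg, logHeight₁_eq_logHeight, ← logHeight_fun_mul_eq (by simp)
    (Function.ne_iff.mpr ⟨0, by simp⟩)]
  refine logHeight_le_of_forall_eq_zero_or_exists_eq fun j ↦ .inr ?_
  rcases j with j | j
  · exact ⟨(1, ⟨j, by omega⟩), by simp⟩
  · exact ⟨(0, ⟨j, by omega⟩), by simp⟩

/-- A bound for the height of the solution of a square linear system whose right-hand side is a
coordinate vector, in terms of the heights of the other rows. -/
lemma logHeight_le_of_mulVec_eq_single [Fintype ι] [DecidableEq ι] (B : Matrix ι ι K)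
    (hB : B.det ≠ 0) (r : ι) (u : ι → K) (hu : B.mulVec u = Pi.single r 1) :
    logHeight u ≤ totalWeight K * Real.log ((Fintype.card ι).factorial) +
      ∑ i : {i // i ≠ r}, logHeight (B i) := by
  have hrow (i : ι) : B i ≠ 0 := fun h ↦ hB (Matrix.det_eq_zero_of_row_eq_zero i (congrFun h))
  have hdet : B.det • u = fun k ↦ B.adjugate k r := by
    have h := congrArg B.adjugate.mulVec hu
    rw [Matrix.mulVec_mulVec, Matrix.adjugate_mul, Matrix.smul_mulVec, Matrix.one_mulVec] at h
    rw [h]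
    ext k
    simp
  -- Leibniz expansion of the adjugate column as a linear image of z, with matrix A of entries 0 and
  -- ±1: only the size of the symmetric group enters the bound.
  let A : ι × Equiv.Perm ι → K := fun p ↦ if p.2 r = p.1 then ((Equiv.Perm.sign p.2 : ℤ) : K) else 0
  let z : Equiv.Perm ι → K := fun σ ↦ ∏ i : {i // i ≠ r}, B i (σ i)
  have hadj : (fun k ↦ B.adjugate k r) = fun k ↦ ∑ σ, A (k, σ) * z σ := by
    ext k
    rw [Matrix.adjugate_apply, ← Matrix.det_transpose, Matrix.det_apply']
    refine Finset.sum_congr rfl fun σ _ ↦ ?_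
    rw [← Finset.mul_prod_erase _ _ (Finset.mem_univ r)]
    have h1 : ∏ i ∈ Finset.univ.erase r, (B.updateRow r (Pi.single k 1)).transpose (σ i) i = z σ := by
      simp only [z]
      rw [← Finset.prod_subtype (Finset.univ.erase r) (p := fun i ↦ i ≠ r) (by simp)
        (fun i ↦ B i (σ i))]
      refine Finset.prod_congr rfl fun i hi ↦ ?_
      simp [Matrix.transpose_apply, Matrix.updateRow_ne (Finset.ne_of_mem_erase hi)]
    rw [h1]
    simp only [A, Matrix.transpose_apply, Matrix.updateRow_self, Pi.single_apply]
    split_ifs <;> simp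
  have hA : logHeight A = 0 := by
    refine logHeight_eq_zero_of_forall fun p ↦ ?_
    simp only [A]
    split_ifs
    · rcases Int.units_eq_one_or (Equiv.Perm.sign p.2) with h | h <;> simp [h]
    · simp
  have hz : logHeight z ≤ ∑ i : {i // i ≠ r}, logHeight (B i) := by
    rw [← logHeight_fun_prod_eq (x := fun i : {i // i ≠ r} ↦ B i) fun i ↦ hrow i]
    exact logHeight_le_of_forall_eq_zero_or_exists_eq fun σ ↦ .inr ⟨fun i ↦ σ i, rfl⟩
  rw [← logHeight_smul_eq_logHeight u hB, hdet, hadj]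
  refine (logHeight_linearMap_apply_le A z).trans ?_
  rw [hA, Nat.card_eq_fintype_card, Fintype.card_perm]
  linarith

end Height

/-! ### Heights of integral elements: only infinite places count -/

namespace NumberField

open Height

variable {L : Type*} [Field L] [NumberField L]

lemma FinitePlace.apply_coe_le_one (v : FinitePlace L) (a : 𝓞 L) : v (a : L) ≤ 1 := by
  rw [← FinitePlace.norm_embedding_eq]
  exact FinitePlace.norm_le_one L v.maximalIdeal a

lemma InfinitePlace.apply_intCast {K : Type*} [Field K] (v : InfinitePlace K) (n : ℤ) : v (n : K) = |(n : ℝ)| := by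
  rw [← InfinitePlace.norm_embedding_eq, map_intCast, Complex.norm_intCast]

lemma mulHeight₁_coe_eq (a : 𝓞 L) :
    mulHeight₁ (a : L) = ∏ v : InfinitePlace L, max (v (a : L)) 1 ^ v.mult := by
  rw [NumberField.mulHeight₁_eq, finprod_eq_one_of_forall_eq_one, mul_one]
  exact fun v ↦ max_eq_right (v.apply_coe_le_one a)

lemma logHeight₁_intCast_le (n : ℤ) {M : ℝ} (hM : 1 ≤ M) (hn : |(n : ℝ)| ≤ M) :
    logHeight₁ (n : L) ≤ Module.finrank ℚ L * Real.log M := by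
  rw [logHeight₁_eq_log_mulHeight₁, ← Real.log_pow, ← InfinitePlace.sum_mult_eq]
  refine Real.log_le_log (mulHeight₁_pos _) ?_
  have h := mulHeight₁_coe_eq (L := L) (n : 𝓞 L)
  rw [show ((n : 𝓞 L) : L) = n by simp] at h
  rw [h, ← Finset.prod_pow_eq_pow_sum]
  refine Finset.prod_le_prod (fun _ _ ↦ by positivity) fun v _ ↦ ?_
  gcongr
  rw [InfinitePlace.apply_intCast]
  exact max_le hn hM

lemma mulHeight_eq_prod_infinitePlace {ι : Type*} [Finite ι] {x : ι → L} {i : ι} (hi : x i = 1)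
    (hx : ∀ j, ∃ a : 𝓞 L, (a : L) = x j) :
    mulHeight x = ∏ v : InfinitePlace L, (⨆ j, v (x j)) ^ v.mult := by
  have : Nonempty ι := ⟨i⟩
  rw [NumberField.mulHeight_eq (Function.ne_iff.mpr ⟨i, by simp [hi]⟩),
    finprod_eq_one_of_forall_eq_one, mul_one]
  refine fun v ↦ le_antisymm (ciSup_le fun j ↦ ?_) (Finite.le_ciSup_of_le i (by simp [hi]))
  obtain ⟨a, ha⟩ := hx j
  exact ha ▸ v.apply_coe_le_one a

end NumberField

/-! ### Common denominators via Minkowski's theorem -/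

namespace NumberField

open Height Module nonZeroDivisors

variable (L : Type*) [Field L] [NumberField L]

/-- Minkowski's theorem for fractional ideals, with the same bound at all infinite places. -/
lemma exists_ne_zero_mem_fractionalIdeal_lt :
    ∃ κ : ℝ, 1 ≤ κ ∧ ∀ (J : (FractionalIdeal (𝓞 L)⁰ L)ˣ) (t : NNReal),
      (t : ℝ) ^ finrank ℚ L = κ * FractionalIdeal.absNorm (J : FractionalIdeal (𝓞 L)⁰ L) →
      ∃ a ∈ (J : FractionalIdeal (𝓞 L)⁰ L), a ≠ 0 ∧ ∀ w : InfinitePlace L, w a < t := by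
  classical
  set V := MeasureTheory.volume (ZSpan.fundamentalDomain (mixedEmbedding.latticeBasis L)) *
    (2 : ENNReal) ^ finrank ℝ (mixedEmbedding.mixedSpace L) with hV
  have hVtop : V ≠ ⊤ := ENNReal.mul_ne_top
    (ZSpan.fundamentalDomain_isBounded _).measure_lt_top.ne (ENNReal.pow_ne_top (by simp))
  have hV0 : 0 ≤ V.toReal := ENNReal.toReal_nonneg
  -- The added 1 gives both κ ≥ 1 and the strict inequality Minkowski requires.
  refine ⟨1 + V.toReal, by linarith, fun J t ht ↦ ?_⟩
  refine mixedEmbedding.exists_ne_zero_mem_ideal_lt L J (f := fun _ ↦ t) ?_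
  have hN : (0 : ℝ) < (FractionalIdeal.absNorm (J : FractionalIdeal (𝓞 L)⁰ L) : ℚ) := by
    refine lt_of_le_of_ne (mod_cast FractionalIdeal.absNorm_nonneg _) ?_
    have h0 : FractionalIdeal.absNorm (J : FractionalIdeal (𝓞 L)⁰ L) ≠ 0 :=
      (_root_.map_ne_zero _).mpr J.ne_zero
    exact mod_cast h0.symm
  rw [mixedEmbedding.convexBodyLT_volume, mixedEmbedding.minkowskiBound,
    mixedEmbedding.volume_fundamentalDomain_fractionalIdealLatticeBasis, mul_assoc, ← hV,
    Finset.prod_pow_eq_pow_sum, InfinitePlace.sum_mult_eq]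
  have htE : ((t : ENNReal)) ^ finrank ℚ L = ENNReal.ofReal
      ((1 + V.toReal) * FractionalIdeal.absNorm (J : FractionalIdeal (𝓞 L)⁰ L)) := by
    rw [← ht, ENNReal.ofReal_pow t.coe_nonneg, ENNReal.ofReal_coe_nnreal]
  refine lt_of_lt_of_le ?_ (le_mul_of_one_le_left' (mod_cast mixedEmbedding.one_le_convexBodyLTFactor L))
  rw [ENNReal.coe_pow, htE, ← ENNReal.ofReal_toReal hVtop, ← ENNReal.ofReal_mul hN.le,
    ENNReal.toReal_ofReal hV0]
  refine (ENNReal.ofReal_lt_ofReal_iff (by positivity)).mpr ?_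
  nlinarith

variable {L}

/-- The fractional ideal of common denominators of a tuple containing `1`. -/
lemma exists_fractionalIdeal_mulHeight_eq {ι : Type*} [Finite ι] (x : ι → L) {i : ι}
    (hi : x i = 1) : ∃ J : (FractionalIdeal (𝓞 L)⁰ L)ˣ,
      (∀ a ∈ (J : FractionalIdeal (𝓞 L)⁰ L), ∀ j, ∃ r : 𝓞 L, (r : L) = a * x j) ∧
      mulHeight x = (∏ v : InfinitePlace L, (⨆ j, v (x j)) ^ v.mult) *
        FractionalIdeal.absNorm (J : FractionalIdeal (𝓞 L)⁰ L) := by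
  have : Nonempty ι := ⟨i⟩
  have := Fintype.ofFinite ι
  obtain ⟨⟨b, hbm⟩, hb⟩ := IsLocalization.exist_integer_multiples (𝓞 L)⁰ Finset.univ x
  have hb0 : b ≠ 0 := nonZeroDivisors.ne_zero hbm
  have hbL : (b : L) ≠ 0 := by simpa using hb0
  choose! y hy using fun j ↦ hb j (Finset.mem_univ j)
  replace hy : ∀ j, (y j : L) = b * x j := fun j ↦ by
    have := hy j
    rw [Algebra.smul_def] at this
    exact this
  have hyi : y i = b := by
    have := hy i
    rw [hi, mul_one] at this
    exact_mod_cast this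
  have hy0 : y ≠ 0 := Function.ne_iff.mpr ⟨i, by simpa [hyi] using hb0⟩
  set I : Ideal (𝓞 L) := Ideal.span (Set.range y) with hI
  have hymem (j) : y j ∈ I := Ideal.subset_span ⟨j, rfl⟩
  have hI0 : I ≠ ⊥ := fun h ↦ hb0 (by simpa [h, hyi] using hymem i)
  have hI0' : (I : FractionalIdeal (𝓞 L)⁰ L) ≠ 0 := FractionalIdeal.coeIdeal_ne_zero.mpr hI0
  -- I is generated by the b x_j, so (b) I⁻¹ consists of the a with every a x_j integral.
  set J : FractionalIdeal (𝓞 L)⁰ L := FractionalIdeal.spanSingleton (𝓞 L)⁰ (b : L) *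
    (I : FractionalIdeal (𝓞 L)⁰ L)⁻¹ with hJ
  have hJ0 : J ≠ 0 := mul_ne_zero (FractionalIdeal.spanSingleton_ne_zero_iff.mpr hbL)
    (inv_ne_zero hI0')
  refine ⟨Units.mk0 J hJ0, fun a ha j ↦ ?_, ?_⟩
  · have h1 : a * (y j : L) ∈ J * (I : FractionalIdeal (𝓞 L)⁰ L) :=
      FractionalIdeal.mul_mem_mul ha (FractionalIdeal.mem_coeIdeal_of_mem _ (hymem j))
    rw [hJ, mul_assoc, inv_mul_cancel₀ hI0', mul_one, FractionalIdeal.mem_spanSingleton] at h1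
    obtain ⟨r, hr⟩ := h1
    refine ⟨r, mul_left_cancel₀ hbL ?_⟩
    rw [Algebra.smul_def, hy j] at hr
    linear_combination hr
  -- The finite part of the height of y is N(I)⁻¹; the factor |N(b)| from the infinite places turns
  -- it into N(J).
  · have h1 := absNorm_mul_finprod_finitePlace_eq_one hy0
    have h2 : mulHeight x = mulHeight (fun j ↦ (y j : L)) := by
      rw [← mulHeight_smul_eq_mulHeight x hbL]
      congr 1
      ext j
      simp [hy j]
    have h3 (v : InfinitePlace L) : (⨆ j, v (y j : L)) = v (b : L) * ⨆ j, v (x j) := by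
      rw [Real.mul_iSup_of_nonneg (apply_nonneg v _)]
      simp [hy]
    have h4 := InfinitePlace.prod_eq_abs_norm (b : L)
    have h5 : (0 : ℝ) < Ideal.absNorm I := by
      exact_mod_cast Nat.pos_of_ne_zero (Ideal.absNorm_eq_zero_iff.not.mpr hI0)
    rw [h2, NumberField.mulHeight_eq (Function.ne_iff.mpr ⟨i, by simpa [hyi] using hb0⟩)]
    simp only [h3, mul_pow, Finset.prod_mul_distrib, h4, Units.val_mk0, hJ, map_mul, map_inv₀,
      FractionalIdeal.absNorm_span_singleton, FractionalIdeal.coeIdeal_absNorm]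
    rw [eq_inv_of_mul_eq_one_right h1]
    push_cast
    ring

/-- Take a in J with all |a|_v < t, where t to the power [L:ℚ] is κ N(J). The tuple z keeps the
entry 1 instead of a, since the height of aP is affine. -/
lemma exists_common_denominator (L : Type*) [Field L] [NumberField L] :
    ∃ κ : ℝ, 1 ≤ κ ∧ ∀ {ι : Type} [Finite ι] (x : ι → L) {i : ι}, x i = 1 →
      ∃ a : 𝓞 L, a ≠ 0 ∧ (∀ j, ∃ r : 𝓞 L, (r : L) = a * x j) ∧
        mulHeight₁ (a : L) ≤ κ * mulHeight x ∧
        ∀ z : ι → L, z i = 1 → (∀ j, j ≠ i → z j = a * x j) → mulHeight z ≤ κ * mulHeight x := by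
  obtain ⟨κ, hκ, H⟩ := exists_ne_zero_mem_fractionalIdeal_lt L
  refine ⟨κ, hκ, fun {ι} _ x i hi ↦ ?_⟩
  have : Nonempty ι := ⟨i⟩
  obtain ⟨J, hJ, hx⟩ := exists_fractionalIdeal_mulHeight_eq x hi
  set N : ℝ := ((FractionalIdeal.absNorm (J : FractionalIdeal (𝓞 L)⁰ L) : ℚ) : ℝ) with hN
  have hN0 : 0 ≤ N := Rat.cast_nonneg.mpr (FractionalIdeal.absNorm_nonneg _)
  have hn : finrank ℚ L ≠ 0 := finrank_pos.ne'
  let t : NNReal := ⟨(κ * N) ^ ((finrank ℚ L : ℝ)⁻¹), by positivity⟩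
  have ht : (t : ℝ) ^ finrank ℚ L = κ * N := Real.rpow_inv_natCast_pow (by positivity) hn
  obtain ⟨a', ha'J, ha'0, ha'⟩ := H J t ht
  obtain ⟨a, ha⟩ := hJ a' ha'J i
  rw [hi, mul_one] at ha
  subst ha
  have ha0 : a ≠ 0 := by simpa using ha'0
  -- A nonzero algebraic integer cannot be less than 1 at every infinite place. Hence the entry 1 is
  -- also dominated by t times the local maximum.
  have ht1 : 1 ≤ (t : ℝ) := by
    obtain ⟨w⟩ : Nonempty (InfinitePlace L) := inferInstance
    by_contra! h
    exact absurd (InfinitePlace.one_le_of_lt_one (w := w) ha0 fun z _ ↦ (ha' z).trans h)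
      (not_le.mpr ((ha' w).trans h))
  have hs (v : InfinitePlace L) : 1 ≤ ⨆ j, v (x j) := Finite.le_ciSup_of_le i (by simp [hi])
  have hprod : ∏ v : InfinitePlace L, ((t : ℝ) * ⨆ j, v (x j)) ^ v.mult = κ * mulHeight x := by
    simp only [mul_pow, Finset.prod_mul_distrib]
    rw [Finset.prod_pow_eq_pow_sum, InfinitePlace.sum_mult_eq, ht, hx]
    ring
  refine ⟨a, ha0, hJ _ ha'J, ?_, fun z hzi hz ↦ ?_⟩
  · rw [mulHeight₁_coe_eq, ← hprod]
    refine Finset.prod_le_prod (fun _ _ ↦ by positivity) fun v _ ↦ ?_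
    gcongr
    exact max_le ((ha' v).le.trans (le_mul_of_one_le_right t.2 (hs v)))
      (one_le_mul_of_one_le_of_one_le ht1 (hs v))
  · rw [mulHeight_eq_prod_infinitePlace hzi fun j ↦ ?_, ← hprod]
    · refine Finset.prod_le_prod
        (fun v _ ↦ pow_nonneg (Real.iSup_nonneg_of_nonnegHomClass v _) _) fun v _ ↦ ?_
      refine pow_le_pow_left₀ (Real.iSup_nonneg_of_nonnegHomClass v _) (ciSup_le fun j ↦ ?_) _
      by_cases hj : j = i
      · rw [hj, hzi, map_one]
        exact one_le_mul_of_one_le_of_one_le ht1 (hs v)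
      · rw [hz j hj, map_mul]
        exact mul_le_mul (ha' v).le (Finite.le_ciSup (fun j ↦ v (x j)) j) (apply_nonneg _ _) t.2
    · by_cases hj : j = i
      · exact ⟨1, by simp [hj, hzi]⟩
      · rw [hz j hj]
        exact hJ _ ha'J j

end NumberField

lemma exists_intPolyToField_eq {L : Type*} [Field L] {P : L[X]}
    (h : ∀ n, ∃ r : 𝓞 L, (r : L) = P.coeff n) : ∃ T : (𝓞 L)[X], intPolyToField T = P := by
  obtain ⟨T, hT⟩ := (lifts_iff_coeff_lifts (f := algebraMap (𝓞 L) L) P).mpr h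
  exact ⟨T, hT⟩

theorem exists_isDenominatorConstant (L : Type*) [Field L] [NumberField L] :
    ∃ C : ℝ, IsDenominatorConstant L C := by
  obtain ⟨κ, hκ, H⟩ := exists_common_denominator L
  have hn : (0 : ℝ) < Module.finrank ℚ L := mod_cast Module.finrank_pos
  refine ⟨Real.log κ / Module.finrank ℚ L, fun P ↦ ?_⟩
  obtain ⟨a, ha0, hint, h1, h2⟩ := H
    (fun i : Option (Fin (P.natDegree + 1)) ↦ i.elim (1 : L) (fun j ↦ P.coeff j)) (i := none) rfl
  have key {h : ℝ} (h0 : 0 < h) (hle : h ≤ κ * Height.mulHeight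
      (fun i : Option (Fin (P.natDegree + 1)) ↦ i.elim (1 : L) (fun j ↦ P.coeff j))) :
      Real.log h / Module.finrank ℚ L ≤ polyHeight P + Real.log κ / Module.finrank ℚ L := by
    rw [polyHeight, ← add_div]
    gcongr
    refine (Real.log_le_log h0 hle).trans ?_
    rw [Real.log_mul (by positivity) (Height.mulHeight_ne_zero _), add_comm,
      Height.logHeight_eq_log_mulHeight]
  have haL : (a : L) ≠ 0 := by simpa using ha0
  refine ⟨a, ha0, exists_intPolyToField_eq fun n ↦ ?_, max_le (key (Height.mulHeight₁_pos _) h1) ?_⟩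
  · rw [coeff_C_mul]
    by_cases hn : n < P.natDegree + 1
    · exact hint (some ⟨n, hn⟩)
    · exact ⟨0, by simp [coeff_eq_zero_of_natDegree_lt (show P.natDegree < n by omega)]⟩
  · refine key (Height.mulHeight_pos _) ?_
    have hdeg : (C (a : L) * P).natDegree = P.natDegree := natDegree_C_mul haL
    rw [hdeg]
    refine h2 _ rfl fun j hj ↦ ?_
    obtain ⟨k, rfl⟩ := Option.ne_none_iff_exists'.mp hj
    simp

/-! ### Rational interpolation as a linear system -/

lemma RatFunc.eval_mul_eval_denom {L : Type*} [Field L] (F : RatFunc L) {x : L}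
    (hx : F.denom.eval x ≠ 0) :
    F.eval (RingHom.id L) x * F.denom.eval x = F.num.eval x := by
  rw [RatFunc.eval, eval₂_id, eval₂_id, div_mul_cancel₀ _ hx]

lemma coeff_sum_C_mul_X_pow {L : Type*} [Field L] {m : ℕ} (w : Fin (m + 1) → L) {j : ℕ} :
    (∑ k : Fin (m + 1), C (w k) * X ^ (k : ℕ)).coeff j =
      if h : j < m + 1 then w ⟨j, h⟩ else 0 := by
  simp only [finsetSum_coeff, coeff_C_mul, coeff_X_pow]
  split_ifs with h
  · rw [Finset.sum_eq_single ⟨j, h⟩] <;> simp +contextual [Fin.ext_iff, eq_comm]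
  · refine Finset.sum_eq_zero fun k _ ↦ ?_
    simp [show j ≠ k by omega]

/-- Uniqueness of rational interpolation. -/
lemma eq_zero_of_interpolation {L : Type*} [Field L] {P Q P' Q' : L[X]} {m n : ℕ}
    (hPQ : IsCoprime P Q) (hQ0 : Q ≠ 0) (hP : P.natDegree ≤ m) (hQ : Q.natDegree = n)
    (hP' : P'.natDegree ≤ m) (hQ' : Q'.natDegree ≤ n) (hc : Q'.coeff n = 0)
    (x y : Fin (m + n + 1) → L) (hx : Function.Injective x)
    (hy : ∀ i, y i * Q.eval (x i) = P.eval (x i))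
    (hy' : ∀ i, P'.eval (x i) = y i * Q'.eval (x i)) : P' = 0 ∧ Q' = 0 := by
  -- Degree at most m + n, with m + n + 1 distinct roots.
  have h0 : P' * Q - P * Q' = 0 := by
    refine eq_zero_of_natDegree_lt_card_of_eval_eq_zero _ hx (fun i ↦ ?_) ?_
    · rw [eval_sub, eval_mul, eval_mul, hy', ← hy]
      ring
    · rw [Fintype.card_fin, Nat.lt_succ_iff]
      refine (natDegree_sub_le _ _).trans (max_le ?_ ?_)
      · exact natDegree_mul_le.trans (by omega)
      · exact natDegree_mul_le.trans (by omega)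
  -- A nonzero multiple of Q has degree at least n, but the coefficient of Q' at n vanishes.
  have hdvd : Q ∣ Q' := hPQ.symm.dvd_of_dvd_mul_left ⟨P', by linear_combination -h0⟩
  have hQ'0 : Q' = 0 := by
    by_contra hne
    have h1 := natDegree_le_of_dvd hdvd hne
    have h2 : Q'.natDegree = n := by omega
    exact hne (leadingCoeff_eq_zero.mp (by rwa [leadingCoeff, h2]))
  rw [hQ'0, mul_zero, sub_zero] at h0
  exact ⟨(mul_eq_zero.mp h0).resolve_right hQ0, hQ'0⟩

/-- The coefficients of a reduced rational fraction with monic denominator have height bounded in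
terms of the heights of enough of its values. -/
lemma logHeight_coeff_num_denom_le {L : Type*} [Field L] [NumberField L] (F : RatFunc L)
    {m n d : ℕ} (hm : F.num.natDegree = m) (hn : F.denom.natDegree = n) (hmd : m ≤ d) (hnd : n ≤ d)
    (x : Fin (m + n + 1) → L) (hx : Function.Injective x) (hpole : ∀ i, F.denom.eval (x i) ≠ 0) :
    Height.logHeight (Sum.elim (fun j : Fin (m + 1) ↦ F.num.coeff j)
      (fun j : Fin (n + 1) ↦ F.denom.coeff j)) ≤
      Module.finrank ℚ L * Real.log ((m + n + 2).factorial) +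
      ∑ i, (Height.logHeight₁ (F.eval (RingHom.id L) (x i)) + d * Height.logHeight₁ (x i)) := by
  set u : Fin (m + 1) ⊕ Fin (n + 1) → L := Sum.elim (fun j ↦ F.num.coeff j)
    (fun j ↦ F.denom.coeff j) with hu
  let y : Fin (m + n + 1) → L := fun i ↦ F.eval (RingHom.id L) (x i)
  -- The index `none` carries the normalization row, which reads off the leading coefficient of the
  -- denominator.
  let row : Option (Fin (m + n + 1)) → Fin (m + 1) ⊕ Fin (n + 1) → L := fun o ↦
    o.elim (Pi.single (Sum.inr (Fin.last n)) 1) fun i ↦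
      Sum.elim (fun j ↦ x i ^ (j : ℕ)) (fun j ↦ -(y i * x i ^ (j : ℕ)))
  have hcard : Fintype.card (Fin (m + 1) ⊕ Fin (n + 1)) = m + n + 2 := by simp; omega
  let e : Fin (m + 1) ⊕ Fin (n + 1) ≃ Option (Fin (m + n + 1)) :=
    Fintype.equivOfCardEq (by rw [hcard]; simp)
  let B : Matrix (Fin (m + 1) ⊕ Fin (n + 1)) (Fin (m + 1) ⊕ Fin (n + 1)) L := fun k ↦ row (e k)
  have hrow_some (v : Fin (m + 1) ⊕ Fin (n + 1) → L) (i : Fin (m + n + 1)) :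
      row (some i) ⬝ᵥ v = (∑ k : Fin (m + 1), C (v (.inl k)) * X ^ (k : ℕ)).eval (x i) -
        y i * (∑ k : Fin (n + 1), C (v (.inr k)) * X ^ (k : ℕ)).eval (x i) := by
    simp only [row, dotProduct, Fintype.sum_sum_type, eval_finsetSum, eval_mul, eval_C, eval_pow,
      eval_X, Option.elim, Sum.elim_inl, Sum.elim_inr, Finset.mul_sum, sub_eq_add_neg,
      ← Finset.sum_neg_distrib]
    congr 1 <;> exact Finset.sum_congr rfl fun _ _ ↦ by ring
  have hrow_none (v : Fin (m + 1) ⊕ Fin (n + 1) → L) :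
      row none ⬝ᵥ v = v (.inr (Fin.last n)) := by
    simp [row]
  have hsum {k : ℕ} {P : L[X]} (hP : P.natDegree = k) :
      ∑ j : Fin (k + 1), C (P.coeff j) * X ^ (j : ℕ) = P := by
    rw [Fin.sum_univ_eq_sum_range (fun j ↦ C (P.coeff j) * X ^ j) (k + 1), ← hP]
    exact P.as_sum_range_C_mul_X_pow.symm
  have hy (i) : y i * F.denom.eval (x i) = F.num.eval (x i) := F.eval_mul_eval_denom (hpole i)
  have hBu : B.mulVec u = Pi.single (e.symm none) 1 := by
    ext k
    change row (e k) ⬝ᵥ u = _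
    rcases h : e k with _ | i
    · rw [hrow_none, show k = e.symm none by rw [← h, e.symm_apply_apply], Pi.single_eq_same, hu,
        Sum.elim_inr, Fin.val_last, ← hn]
      exact F.monic_denom
    · rw [hrow_some, Pi.single_eq_of_ne (by rintro rfl; simp at h)]
      simp only [hu, Sum.elim_inl, Sum.elim_inr]
      rw [hsum hm, hsum hn, hy, sub_self]
  have hdet : B.det ≠ 0 := by
    rw [Ne, ← Matrix.exists_mulVec_eq_zero_iff]
    rintro ⟨v, hv0, hv⟩
    have hv' (o) : row o ⬝ᵥ v = 0 := by
      simpa [B, Matrix.mulVec] using congrFun hv (e.symm o)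
    have hdeg {k : ℕ} (w : Fin (k + 1) → L) :
        (∑ j : Fin (k + 1), C (w j) * X ^ (j : ℕ)).natDegree ≤ k :=
      natDegree_sum_le_of_forall_le _ _ fun j _ ↦
        (natDegree_C_mul_X_pow_le _ _).trans (Nat.lt_succ_iff.mp j.2)
    obtain ⟨h1, h2⟩ := eq_zero_of_interpolation F.isCoprime_num_denom F.denom_ne_zero hm.le hn
      (hdeg fun j ↦ v (.inl j)) (hdeg fun j ↦ v (.inr j))
      (by rw [coeff_sum_C_mul_X_pow, dif_pos (Nat.lt_succ_self n)]
          exact (hrow_none v).symm.trans (hv' none)) x y hx hy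
      (fun i ↦ sub_eq_zero.mp ((hrow_some v i).symm.trans (hv' (some i))))
    refine hv0 (funext fun k ↦ ?_)
    rcases k with k | k
    · have h := congrArg (coeff · (k : ℕ)) h1
      simp only [coeff_sum_C_mul_X_pow, dif_pos k.2] at h
      exact h
    · have h := congrArg (coeff · (k : ℕ)) h2
      simp only [coeff_sum_C_mul_X_pow, dif_pos k.2] at h
      exact h
  refine (Height.logHeight_le_of_mulVec_eq_single B hdet _ u hBu).trans ?_
  rw [hcard, totalWeight_eq_finrank]
  gcongr
  have hreindex : ∑ k : {k // k ≠ e.symm none}, Height.logHeight (B k) =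
      ∑ i, Height.logHeight (row (some i)) := by
    rw [← Finset.sum_subtype (Finset.univ.erase (e.symm none)) (p := fun k ↦ k ≠ e.symm none)
      (by simp) (fun k ↦ Height.logHeight (B k))]
    have h1 := Finset.add_sum_erase Finset.univ (fun k ↦ Height.logHeight (B k))
      (Finset.mem_univ (e.symm none))
    have h2 : ∑ k, Height.logHeight (B k) = ∑ o, Height.logHeight (row o) :=
      e.sum_comp fun o ↦ Height.logHeight (row o)
    rw [h2, Fintype.sum_option] at h1
    have h3 : B (e.symm none) = row none := by simp [B]
    rw [h3] at h1
    linarith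
  rw [hreindex]
  exact Finset.sum_le_sum fun i _ ↦ Height.logHeight_interpolation_row_le (x i) (y i) hmd hnd

/-! ### Polynomial heights and the final estimate -/

lemma polyHeight_le {L : Type*} [Field L] [NumberField L] {ι : Type*} [Finite ι] {P : L[X]}
    {u : ι → L} {i : ι} (hi : u i = 1) (h : ∀ n, P.coeff n = 0 ∨ ∃ j, P.coeff n = u j) :
    polyHeight P ≤ Height.logHeight u / Module.finrank ℚ L := by
  rw [polyHeight]
  gcongr
  refine Height.logHeight_le_of_forall_eq_zero_or_exists_eq fun k ↦ ?_
  rcases k with _ | k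
  · exact .inr ⟨i, hi.symm⟩
  · exact h k

lemma polyHeight_le_polyHeight {L : Type*} [Field L] [NumberField L] {P Q : L[X]}
    (h : ∀ n, P.coeff n = 0 ∨ ∃ j, P.coeff n = Q.coeff j) : polyHeight P ≤ polyHeight Q := by
  refine polyHeight_le (i := none) rfl fun n ↦ ?_
  rcases h n with h | ⟨j, hj⟩
  · exact .inl h
  by_cases hjd : j < Q.natDegree + 1
  · exact .inr ⟨some ⟨j, hjd⟩, hj⟩
  · exact .inl (hj.trans (coeff_eq_zero_of_natDegree_lt (by omega)))

lemma weilHeight_nonneg {L : Type*} [Field L] [NumberField L] (a : L) : 0 ≤ weilHeight a :=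
  div_nonneg (Height.zero_le_logHeight₁ a) (Nat.cast_nonneg _)

lemma IsDenominatorConstant.nonneg {L : Type*} [Field L] [NumberField L] {C : ℝ}
    (hC : IsDenominatorConstant L C) : 0 ≤ C := by
  obtain ⟨a, -, -, h⟩ := hC 0
  have h0 : polyHeight (0 : L[X]) ≤ 0 := by
    refine (polyHeight_le (u := fun _ : Unit ↦ (1 : L)) (i := ()) rfl (by simp)).trans ?_
    simp
  linarith [weilHeight_nonneg (a : L), (le_max_left _ _).trans h]

/-- The surplus log 2 comes from 2d + 2 ≤ 2(2d + 1); it is later absorbed by the log(2M) term. -/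
lemma log_factorial_le {d N : ℕ} (hd : 1 ≤ d) (hN : N ≤ 2 * d + 2) :
    Real.log N.factorial ≤ Real.log 2 + (2 * d + 2) * Real.log (2 * d + 1) := by
  have h : N.factorial ≤ 2 * (2 * d + 1) ^ (2 * d + 2) := calc
    N.factorial ≤ (2 * d + 1 + 1).factorial := Nat.factorial_le hN
    _ = (2 * d + 2) * (2 * d + 1).factorial := Nat.factorial_succ _
    _ ≤ (2 * (2 * d + 1)) * (2 * d + 1) ^ (2 * d + 1) :=
      Nat.mul_le_mul (by omega) (Nat.factorial_le_pow _)
    _ = _ := by ring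
  have h2 : (N.factorial : ℝ) ≤ 2 * (2 * d + 1) ^ (2 * d + 2) := by exact_mod_cast h
  refine (Real.log_le_log (by positivity) h2).trans ?_
  rw [Real.log_mul (by norm_num) (by positivity), Real.log_pow]
  push_cast
  rfl

theorem proposition5p2 (L : Type*) [Field L] [NumberField L] :
    (∃ C : ℝ, IsDenominatorConstant L C) ∧
    ∀ C : ℝ, IsDenominatorConstant L C →
      ∀ (A B : ℤ) (F : RatFunc L) (dP dQ d : ℕ) (H : ℝ) (x : Fin (dP + dQ + 1) → ℤ),
        F ≠ 0 →
        F.num.natDegree = dP →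
        F.denom.natDegree = dQ →
        d = max dP dQ →
        1 ≤ d →
        Function.Injective x →
        (∀ i, x i ∈ Set.Icc A B) →
        (∀ i, F.denom.eval (x i : L) ≠ 0) →
        (∀ i, weilHeight (F.eval (RingHom.id L) (x i : L)) ≤ H) →
        ∃ P Q : (𝓞 L)[X],
          Q ≠ 0 ∧
          F = algebraMap L[X] (RatFunc L) (intPolyToField P) /
                algebraMap L[X] (RatFunc L) (intPolyToField Q) ∧
          P.natDegree = dP ∧
          Q.natDegree = dQ ∧
          max (polyHeight (intPolyToField P)) (polyHeight (intPolyToField Q)) ≤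
            ((d : ℝ) + 1) * (2 * d + 1) * H
              + ((d : ℝ) + 1) * ((B : ℝ) - A) * Real.log ((B : ℝ) - A)
              + (4 * (d : ℝ) ^ 2 + 3 * d) * Real.log (2 * max |(A : ℝ)| |(B : ℝ)|)
              + (2 * (d : ℝ) + 2) * Real.log (2 * d + 1)
              + ((d : ℝ) + 1) * C := by
  refine ⟨exists_isDenominatorConstant L, ?_⟩
  intro c hc A B F m n d H x hF0 hm hn hd hd1 hx hxAB hpole hH
  have hmd : m ≤ d := hd ▸ le_max_left _ _
  have hnd : n ≤ d := hd ▸ le_max_right _ _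
  have hc0 := hc.nonneg
  have hH0 : 0 ≤ H := (weilHeight_nonneg _).trans (hH 0)
  set M : ℝ := max |(A : ℝ)| |(B : ℝ)| with hM
  -- As d ≥ 1 there are at least two distinct points.
  have hAB : (1 : ℝ) ≤ (B : ℝ) - A := by
    have h01 : x 0 ≠ x (Fin.last _) := hx.ne (by simp [Fin.ext_iff]; omega)
    have h0 := hxAB 0
    have h1 := hxAB (Fin.last _)
    simp only [Set.mem_Icc] at h0 h1
    have : A + 1 ≤ B := by omega
    have : (A : ℝ) + 1 ≤ B := by exact_mod_cast this
    linarith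
  have hM1 : 1 ≤ M := by
    have h : A ≠ 0 ∨ B ≠ 0 := by
      by_contra! h
      rw [h.1, h.2] at hAB
      norm_num at hAB
    rcases h with h | h
    · exact le_max_of_le_left (by exact_mod_cast Int.one_le_abs h)
    · exact le_max_of_le_right (by exact_mod_cast Int.one_le_abs h)
  have hxM (i) : |(x i : ℝ)| ≤ M := by
    obtain ⟨h1, h2⟩ := hxAB i
    exact abs_le_max_abs_abs (by exact_mod_cast h1) (by exact_mod_cast h2)
  have hr : (0 : ℝ) < Module.finrank ℚ L := mod_cast Module.finrank_pos
  have hu := logHeight_coeff_num_denom_le F hm hn hmd hnd (fun i ↦ (x i : L))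
    (fun i j hij ↦ hx (by simpa using hij)) hpole
  set u : Fin (m + 1) ⊕ Fin (n + 1) → L := Sum.elim (fun j ↦ F.num.coeff j)
    (fun j ↦ F.denom.coeff j) with hu_def
  -- The shift by m + 1 keeps the two coefficient lists disjoint, so one denominator of R serves
  -- both.
  set R : L[X] := F.num + X ^ (m + 1) * F.denom with hR
  have hRlow (j : ℕ) (hj : j < m + 1) : R.coeff j = F.num.coeff j := by
    rw [hR, coeff_add, coeff_X_pow_mul', if_neg (by omega), add_zero]
  have hRhigh (j : ℕ) : R.coeff (j + (m + 1)) = F.denom.coeff j := by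
    rw [hR, coeff_add, coeff_X_pow_mul, coeff_eq_zero_of_natDegree_lt (by omega), zero_add]
  have hnum (j : ℕ) : F.num.coeff j = 0 ∨ F.num.coeff j = R.coeff j := by
    by_cases hj : j < m + 1
    · exact .inr (hRlow j hj).symm
    · exact .inl (coeff_eq_zero_of_natDegree_lt (by omega))
  have hRu : polyHeight R ≤ Height.logHeight u / Module.finrank ℚ L := by
    refine polyHeight_le (i := .inr (Fin.last n)) ?_ fun j ↦ ?_
    · simp only [hu_def, Sum.elim_inr, Fin.val_last, ← hn]
      exact F.monic_denom
    · by_cases hj : j < m + 1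
      · exact .inr ⟨.inl ⟨j, hj⟩, hRlow j hj⟩
      · obtain ⟨k, rfl⟩ := Nat.exists_eq_add_of_le' (not_lt.mp hj)
        rw [hRhigh]
        by_cases hk : k < n + 1
        · exact .inr ⟨.inr ⟨k, hk⟩, rfl⟩
        · exact .inl (coeff_eq_zero_of_natDegree_lt (by omega))
  have hbound : polyHeight R ≤ Real.log ((m + n + 2).factorial) +
      (m + n + 1) * (H + d * Real.log M) := by
    refine hRu.trans ((div_le_iff₀ hr).mpr (hu.trans ?_))
    have h1 : ∑ i, (Height.logHeight₁ (F.eval (RingHom.id L) (x i : L)) +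
        d * Height.logHeight₁ (x i : L)) ≤
        ∑ _i : Fin (m + n + 1), Module.finrank ℚ L * (H + d * Real.log M) := by
      refine Finset.sum_le_sum fun i _ ↦ ?_
      have h2 := (div_le_iff₀ hr).mp (hH i)
      have h3 := mul_le_mul_of_nonneg_left (logHeight₁_intCast_le (L := L) (x i) hM1 (hxM i))
        (Nat.cast_nonneg (α := ℝ) d)
      linarith
    rw [Finset.sum_const, Finset.card_univ, Fintype.card_fin, nsmul_eq_mul] at h1
    push_cast at h1
    linarith
  obtain ⟨a, ha0, ⟨T, hT⟩, hle⟩ := hc R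
  have haL : (a : L) ≠ 0 := by simpa using ha0
  have hTc (j : ℕ) : ((T.coeff j : 𝓞 L) : L) = a * R.coeff j := by
    have h := congrArg (coeff · j) hT
    simp only [intPolyToField, coeff_map, coeff_C_mul] at h
    exact h
  obtain ⟨P, hP⟩ : ∃ P : (𝓞 L)[X], intPolyToField P = C (a : L) * F.num := by
    refine exists_intPolyToField_eq fun j ↦ ?_
    rw [coeff_C_mul]
    rcases hnum j with h | h
    · exact ⟨0, by simp [h]⟩
    · exact ⟨_, h ▸ hTc j⟩
  obtain ⟨Q, hQ⟩ : ∃ Q : (𝓞 L)[X], intPolyToField Q = C (a : L) * F.denom := by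
    refine exists_intPolyToField_eq fun j ↦ ?_
    rw [coeff_C_mul]
    exact ⟨_, hRhigh j ▸ hTc _⟩
  have hinj : Function.Injective (algebraMap (𝓞 L) L) := RingOfIntegers.coe_injective
  have hdeg (S : (𝓞 L)[X]) : (intPolyToField S).natDegree = S.natDegree :=
    natDegree_map_eq_of_injective hinj S
  have hCa : C (a : L) ≠ 0 := C_ne_zero.mpr haL
  refine ⟨P, Q, ?_, ?_, ?_, ?_, ?_⟩
  · rintro rfl
    rw [intPolyToField, Polynomial.map_zero] at hQ
    exact mul_ne_zero hCa F.denom_ne_zero hQ.symm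
  · rw [hP, hQ, map_mul, map_mul, mul_div_mul_left _ _ (RatFunc.algebraMap_ne_zero hCa),
      RatFunc.num_div_denom]
  · rw [← hdeg, hP, natDegree_C_mul haL, hm]
  · rw [← hdeg, hQ, natDegree_C_mul haL, hn]
  · have hPR : polyHeight (intPolyToField P) ≤ polyHeight (C (a : L) * R) := by
      rw [hP]
      refine polyHeight_le_polyHeight fun j ↦ ?_
      simp only [coeff_C_mul]
      rcases hnum j with h | h
      · exact .inl (by rw [h, mul_zero])
      · exact .inr ⟨j, by rw [h]⟩
    have hQR : polyHeight (intPolyToField Q) ≤ polyHeight (C (a : L) * R) := by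
      rw [hQ]
      refine polyHeight_le_polyHeight fun j ↦ .inr ⟨j + (m + 1), ?_⟩
      rw [coeff_C_mul, coeff_C_mul, hRhigh]
    refine (max_le hPR hQR).trans (((le_max_right _ _).trans hle).trans ?_)
    have hfac := log_factorial_le hd1 (show m + n + 2 ≤ 2 * d + 2 by omega)
    have hD : 0 ≤ ((d : ℝ) + 1) * ((B : ℝ) - A) * Real.log ((B : ℝ) - A) :=
      mul_nonneg (by nlinarith [Nat.cast_nonneg (α := ℝ) d]) (Real.log_nonneg hAB)
    have hlogM : 0 ≤ Real.log M := Real.log_nonneg hM1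
    have hlog2 : 0 ≤ Real.log 2 := Real.log_nonneg (by norm_num)
    have hd1' : (1 : ℝ) ≤ d := by exact_mod_cast hd1
    have hmn : ((m : ℝ) + n + 1) ≤ 2 * d + 1 := by
      exact_mod_cast (show m + n + 1 ≤ 2 * d + 1 by omega)
    have hstep : ((m : ℝ) + n + 1) * (H + d * Real.log M) ≤ (2 * d + 1) * (H + d * Real.log M) := by
      gcongr
    rw [Real.log_mul (by norm_num) (by positivity)]
    -- The differences between the stated coefficients and those obtained, all nonnegative.
    have e1 : (0 : ℝ) ≤ d * (2 * d + 1) * H := by positivity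
    have e2 : (0 : ℝ) ≤ d * c := by positivity
    have e3 : (0 : ℝ) ≤ (2 * d ^ 2 + 2 * d) * Real.log M := by positivity
    have e4 : (0 : ℝ) ≤ (4 * d ^ 2 + 3 * d - 1) * Real.log 2 :=
      mul_nonneg (by nlinarith) hlog2
    linarith
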